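/- All graphs are finite. A connected graph $G$ is \emph{matching covered} if every edge of $G$ lies in a perfect matching of $G$. For $X\subseteq V(G)$ let $\partial(X)$ be the set of edges of $G$ with exactly one end in $X$, and let $\mathsf{mp}(\partial(X))=\max_M|M\cap\partial(X)|$, where $M$ ranges over the perfect matchings of $G$. A \emph{perfect matching decomposition} of $G$ is a pair $(T,\delta)$ of a tree $T$ all of whose inner vertices have degree three and a bijection $\delta$ from the leaves of $T$ to $V(G)$; its width is the maximum, over all edges $e$ of $T$, of $\mathsf{mp}(\partial(X_e))$, where $X_e$ is the image under $\delta$ of the leaves of $T$ in one of the two components of $T-e$. The \emph{perfect matching width} $\mathsf{pmw}(G)$ is the minimum width of a perfect matching decomposition of $G$. For a bipartite graph $G$ with colour classes $A,B$ and a perfect matching $M$, the \emph{$M$-direction} of $G$ is the digraph with vertex set $M$ that has an arc from $e$ to $f\neq e$ if $G$ has an edge from the end of $e$ in $A$ to the end of $f$ in $B$. The \emph{cylindrical grid} of order $k\ge 1$ has the vertices $(i,j)$ with $0\le i<k$ and $j\in\mathbb{Z}/2k$ and consists of the $k$ directed cycles formed by the arcs $(i,j)\to(i,j+1)$, for $i=0$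 (innermost) up to $i=k-1$ (outermost), and of $2k$ directed paths, with arcs $(i,j)\to(i+1,j)$ for even $j$ and $(i+1,j)\to(i,j)$ for odd $j$. Let $E_o$ and $E_i$ be sets of arcs that consist of every second arc of the outermost and of the innermost cycle, respectively; any of the two choices is allowed for each of them. Contract all arcs in $E_o\cup E_i$, that is, identify their ends and delete loops and parallel arcs. A \emph{bipartite matching grid of order $k$} (for this choice of $E_o$ and $E_i$) is a bipartite matching covered graph that has a perfect matching $M$ such that its $M$-direction, for a suitable naming $A,B$ of its colour classes, is isomorphic to the contracted digraph. \textbf{Lemma.} For every integer $k\ge 1$ and every choice of $E_o$ and $E_i$, a bipartite matching grid of order $k$ exists, and every bipartite matching grid $G$ of order $k$ satisfies $\mathsf{pmw}(G)\ge \tfrac13 k$. -/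

import Mathlib

open SimpleGraph

/-! ### Perfect matchings, cuts and perfect matching width -/

/-- A graph is matching covered if it is connected and every edge lies in a perfect matching. -/
def IsMatchingCovered {V : Type*} (G : SimpleGraph V) : Prop :=
  G.Connected ∧ ∀ e ∈ G.edgeSet, ∃ M : G.Subgraph, M.IsPerfectMatching ∧ e ∈ M.edgeSet

/-- The cut at `X`: all edges of `G` that join a vertex of `X` to a vertex outside `X`. -/
def edgeCut {V : Type*} (G : SimpleGraph V) (X : Set V) : Set (Sym2 V) :=
  {e | ∃ x ∈ X, ∃ y ∉ X, G.Adj x y ∧ e = s(x, y)}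

/-- The matching porosity of the cut at `X`: the maximum number of edges of the cut
in a perfect matching of `G`. -/
noncomputable def matchingPorosity {V : Type*} (G : SimpleGraph V) (X : Set V) : ℕ :=
  sSup {n | ∃ M : G.Subgraph, M.IsPerfectMatching ∧ n = (M.edgeSet ∩ edgeCut G X).ncard}

/-- The leaves of a tree. -/
def treeLeaves {W : Type*} (T : SimpleGraph W) : Set W :=
  {t | (T.neighborSet t).ncard = 1}

/-- A (perfect matching) decomposition of a graph with vertex set `V`: a finite cubic tree,
i.e. one whose vertices that are not leaves all have degree three, with a bijection from its
leaves to `V`. Up to isomorphism the vertices of the tree are `0, …, size - 1`. -/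
structure LeafDecomposition (V : Type*) where
  size : ℕ
  tree : SimpleGraph (Fin size)
  isTree : tree.IsTree
  cubic : ∀ t, t ∉ treeLeaves tree → (tree.neighborSet t).ncard = 3
  leafEquiv : treeLeaves tree ≃ V

namespace LeafDecomposition

variable {V : Type*}

/-- The vertices of `V` that are mapped to the leaves of the component of `T - tt'`
that contains `t`. -/
def shore (D : LeafDecomposition V) (t t' : Fin D.size) : Set V :=
  {v | (D.tree.deleteEdges {s(t, t')}).Reachable t (D.leafEquiv.symm v)}

/-- The width of a decomposition as a perfect matching decomposition of `G`: the maximum of the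
matching porosities of the cuts given by the edges of the tree. -/
noncomputable def matchingWidth (D : LeafDecomposition V) (G : SimpleGraph V) : ℕ :=
  sSup {n | ∃ t t', D.tree.Adj t t' ∧ n = matchingPorosity G (D.shore t t')}

end LeafDecomposition

/-- The perfect matching width of `G`: the minimum width of a perfect matching decomposition. -/
noncomputable def perfectMatchingWidth {V : Type*} (G : SimpleGraph V) : ℕ :=
  sInf {w | ∃ D : LeafDecomposition V, w = D.matchingWidth G}

/-! ### The `M`-direction of a bipartite graph -/

/-- The `M`-direction of a bipartite graph `G` with colour classes `A` and `Aᶜ`: its vertices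
are the edges of `M`, and there is an arc from `e` to another edge `f` if `G` has an edge from
the end of `e` in `A` to the end of `f` outside `A`. -/
def matchingDirection {V : Type*} (G : SimpleGraph V) (A : Set V) (M : G.Subgraph) :
    Digraph M.edgeSet where
  Adj e f := e ≠ f ∧ ∃ a ∈ A, ∃ b ∉ A, a ∈ (e : Sym2 V) ∧ b ∈ (f : Sym2 V) ∧ G.Adj a b

/-! ### The cylindrical grid and the bipartite matching grid -/

/-- The cylindrical grid of order `k`. The vertex `(i, j)` is the `j`-th vertex of the `i`-th
concentric directed cycle, where cycle `0` is the innermost one and cycle `k - 1` the outermost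
one. The `2 * k` paths, one for each `j`, are directed outwards for even `j` and inwards for
odd `j`. -/
def cylindricalGrid (k : ℕ) : Digraph (Fin k × ZMod (2 * k)) where
  Adj u v :=
    (v.1 = u.1 ∧ v.2 = u.2 + 1) ∨
    (v.2 = u.2 ∧ Even u.2.val ∧ v.1.val = u.1.val + 1) ∨
    (v.2 = u.2 ∧ Odd u.2.val ∧ u.1.val = v.1.val + 1)

/-- The `j`-th arc of the `i`-th concentric cycle of the cylindrical grid. -/
def cycleArc {k : ℕ} (i : Fin k) (j : ZMod (2 * k)) :
    (Fin k × ZMod (2 * k)) × (Fin k × ZMod (2 * k)) :=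
  ((i, j), (i, j + 1))

/-- `E` consists of every second arc of the `i`-th concentric cycle: all members of `E` are arcs
of this cycle, and of any two consecutive arcs of the cycle exactly one is in `E`. -/
def IsEverySecondArc {k : ℕ} (i : Fin k)
    (E : Set ((Fin k × ZMod (2 * k)) × (Fin k × ZMod (2 * k)))) : Prop :=
  (∀ e ∈ E, ∃ j, e = cycleArc i j) ∧
    ∀ j, cycleArc i (j + 1) ∈ E ↔ cycleArc i j ∉ E

/-- The digraph obtained from `D` by contracting all arcs in `E`: the ends of every arc in `E`
are identified, and loops and parallel arcs are removed. -/
def contractArcs {V : Type*} (D : Digraph V) (E : Set (V × V)) :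
    Digraph (Quot fun u v : V => (u, v) ∈ E) where
  Adj x y := x ≠ y ∧ ∃ u v, Quot.mk _ u = x ∧ Quot.mk _ v = y ∧ D.Adj u v

/-- `G` is the bipartite matching grid of order `k` obtained by contracting the arcs in
`Eo` and `Ei` in the cylindrical grid: it is a bipartite matching covered graph that has a
perfect matching `M` such that its `M`-direction is (isomorphic to) the contracted grid. -/
def IsBipartiteMatchingGrid (k : ℕ)
    (Eo Ei : Set ((Fin k × ZMod (2 * k)) × (Fin k × ZMod (2 * k))))
    {V : Type*} (G : SimpleGraph V) : Prop :=
  IsMatchingCovered G ∧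
    ∃ A : Set V, G.IsBipartiteWith A Aᶜ ∧
      ∃ M : G.Subgraph, M.IsPerfectMatching ∧
        Nonempty ((matchingDirection G A M).Adj ≃r
          (contractArcs (cylindricalGrid k) (Eo ∪ Ei)).Adj)

/-! Every permutation of the contracted grid that fixes each vertex or moves it along an arc gives a
perfect matching of `G`: the `A`-end of `q` is matched to the `B`-end of `σ q`. Three kinds of
permutation suffice: the identity, which gives `M`; the rotation of any chosen set of concentric
cycles; and the step along all radial arcs. The last one is a permutation because of the
contraction. On the innermost and the outermost cycle it merges the end of each radial path with the
start of a neighbouring one of opposite direction, so that every contracted vertex has exactly one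
radial arc in and one out.

For the lower bound, mark one vertex on each of the `k` cycles. Some edge of an optimal cubic tree
leaves at least a third of the marked vertices on either side; let `X` be its shore
(`exists_balanced_matchingPorosity_le`). Cycles can be rotated independently, so one perfect
matching crosses the cut on every cycle that meets both sides
(`card_le_matchingPorosity_of_crossing`). If there are fewer than `k / 3` such cycles, then one
cycle lies entirely in `X` and another entirely outside. Each of the `2 * k` columns then contains a
crossing edge of `M` or a crossing radial edge, so `M` or the radial matching crosses at least `k`
times (`le_matchingPorosity_of_separated`).

For existence, split every vertex of the contracted grid into two adjacent copies. Every arc is used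
by a rotation or by the radial permutation, so the split graph is matching covered. Order one is
separate: the contracted grid is a single vertex, and a positive width is enough. -/

/-! ### Trees and leaf decompositions -/

namespace SimpleGraph

variable {W : Type*} {T : SimpleGraph W}

/-- The vertices of the component of `T - tt'` that contains `t`. -/
def edgeSide (T : SimpleGraph W) (t t' : W) : Set W :=
  {v | (T.deleteEdges {s(t, t')}).Reachable t v}

lemma mem_edgeSide_self (t t' : W) : t ∈ T.edgeSide t t' := Reachable.refl _

lemma mem_edgeSide_of_adj {t t' v w : W} (hv : v ∈ T.edgeSide t t') (h : T.Adj v w)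
    (hne : s(v, w) ≠ s(t, t')) : w ∈ T.edgeSide t t' :=
  Reachable.trans hv (Adj.reachable (by simpa [deleteEdges_adj, h] using hne))

lemma IsTree.disjoint_edgeSide (hT : T.IsTree) {t t' : W} (h : T.Adj t t') {v : W}
    (hv : v ∈ T.edgeSide t t') : v ∉ T.edgeSide t' t := by
  intro hv'
  have hb := isAcyclic_iff_forall_isBridge.1 hT.isAcyclic (e := s(t, t')) h
  rw [isBridge_iff] at hb
  refine hb ?_
  have h' : (T.deleteEdges {s(t, t')}).Reachable t' v := by
    simpa [edgeSide, Sym2.eq_swap] using hv'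
  exact Reachable.trans hv h'.symm

lemma Connected.mem_edgeSide_or (hT : T.Connected) (t t' v : W) :
    v ∈ T.edgeSide t t' ∨ v ∈ T.edgeSide t' t := by
  obtain ⟨p⟩ := hT.preconnected v t
  induction p with
  | nil => exact .inl (mem_edgeSide_self _ _)
  | @cons u w x h p ih =>
    by_cases he : s(w, u) = s(x, t')
    · rcases Sym2.eq_iff.1 he with ⟨-, rfl⟩ | ⟨-, rfl⟩
      · exact .inr (mem_edgeSide_self _ _)
      · exact .inl (mem_edgeSide_self _ _)
    · rcases ih with ih | ih
      · exact .inl (mem_edgeSide_of_adj ih h.symm he)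
      · exact .inr (mem_edgeSide_of_adj ih h.symm (by rwa [Sym2.eq_swap (a := t')]))

lemma Connected.exists_mem_edgeSide (hT : T.Connected) {t v : W} (hv : v ≠ t) :
    ∃ s, T.Adj s t ∧ v ∈ T.edgeSide s t := by
  obtain ⟨p⟩ := hT.preconnected v t
  induction p with
  | nil => exact absurd rfl hv
  | @cons u w x h p ih =>
    by_cases hw : w = x
    · subst hw
      exact ⟨u, h, mem_edgeSide_self _ _⟩
    · obtain ⟨s, hs, hws⟩ := ih hw
      refine ⟨s, hs, mem_edgeSide_of_adj hws h.symm fun he => ?_⟩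
      rcases Sym2.eq_iff.1 he with ⟨-, h2⟩ | ⟨h1, -⟩
      · exact hv h2
      · exact hw h1

/-- The component of `t` in `T - tt'` avoids `t'`, so deleting the edge `t'p` destroys none of its
edges, and the edge `tt'` attaches it to `t'`. The inclusion is strict because of `t'` itself. -/
lemma IsTree.edgeSide_ssubset (hT : T.IsTree) {t t' p : W} (h : T.Adj t t') (hp : p ≠ t) :
    T.edgeSide t t' ⊂ T.edgeSide t' p := by
  have hnot : t' ∉ T.edgeSide t t' := fun h' =>
    hT.disjoint_edgeSide h h' (mem_edgeSide_self _ _)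
  have hstep : ∀ {u w}, (T.deleteEdges {s(t, t')}).Walk u w → w ∈ T.edgeSide t t' →
      w ∈ T.edgeSide t' p → u ∈ T.edgeSide t' p := by
    intro u w q
    induction q with
    | nil => exact fun _ h => h
    | @cons u w x huw q ih =>
      intro hx hx'
      have hw : w ∈ T.edgeSide t t' := Reachable.trans hx ⟨q.reverse⟩
      have hu : u ∈ T.edgeSide t t' := Reachable.trans hw huw.symm.reachable
      refine mem_edgeSide_of_adj (ih hx hx') (deleteEdges_adj.1 huw).1.symm fun he => ?_
      rcases Sym2.eq_iff.1 he with ⟨h1, -⟩ | ⟨-, h2⟩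
      · exact hnot (h1 ▸ hw)
      · exact hnot (h2 ▸ hu)
  refine ⟨fun v hv => ?_, fun hsub => hnot (hsub (mem_edgeSide_self _ _))⟩
  obtain ⟨q⟩ : (T.deleteEdges {s(t, t')}).Reachable v t := Reachable.symm hv
  refine hstep q (mem_edgeSide_self _ _) (mem_edgeSide_of_adj (mem_edgeSide_self _ _) h.symm ?_)
  intro he
  rcases Sym2.eq_iff.1 he with ⟨-, h2⟩ | ⟨-, h2⟩
  · exact hp h2.symm
  · exact h.ne h2

end SimpleGraph

namespace LeafDecomposition

variable {V : Type*} (D : LeafDecomposition V)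

lemma mem_shore {t t' : Fin D.size} {v : V} :
    v ∈ D.shore t t' ↔ (D.leafEquiv.symm v : Fin D.size) ∈ D.tree.edgeSide t t' := Iff.rfl

lemma compl_shore {t t' : Fin D.size} (h : D.tree.Adj t t') :
    (D.shore t t')ᶜ = D.shore t' t := by
  ext v
  rw [Set.mem_compl_iff, mem_shore, mem_shore]
  refine ⟨fun hv => (D.isTree.connected.mem_edgeSide_or t t' _).resolve_left hv,
    fun hv => D.isTree.disjoint_edgeSide h.symm hv⟩

open Classical in
/-- Some edge of the tree of a leaf decomposition splits `S` into two parts both of which contain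
at least a third of `S`. -/
lemma exists_balanced (S : Finset V) (hS : 2 ≤ S.card) :
    ∃ t t', D.tree.Adj t t' ∧ S.card ≤ 3 * (S.filter (· ∈ D.shore t t')).card ∧
      S.card ≤ 3 * (S.filter (· ∉ D.shore t t')).card := by
  by_contra! hcon
  have hcompl : ∀ {t t'}, D.tree.Adj t t' →
      S.filter (· ∉ D.shore t t') = S.filter (· ∈ D.shore t' t) := fun {t t'} h => by
    simp only [← D.compl_shore h, Set.mem_compl_iff]
  have hsum : ∀ {t t'}, D.tree.Adj t t' →
      (S.filter (· ∈ D.shore t t')).card + (S.filter (· ∈ D.shore t' t)).card = S.card :=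
    fun {t t'} h => by
      rw [← hcompl h, Finset.card_filter_add_card_filter_not]
  have hor : ∀ {t t'}, D.tree.Adj t t' → 3 * (S.filter (· ∈ D.shore t t')).card < S.card ∨
      3 * (S.filter (· ∈ D.shore t' t)).card < S.card := fun {t t'} h => by
    by_contra! h'
    have := hcon t t' h h'.1
    rw [hcompl h] at this
    omega
  -- Without a balanced edge, every tree edge has a light side, one with less than a third of `S`. A
  -- light side with maximal vertex set yields a contradiction at the far end `t'` of its edge.
  let P : Set (Fin D.size × Fin D.size) := {d | D.tree.Adj d.1 d.2 ∧
    3 * (S.filter (· ∈ D.shore d.1 d.2)).card < S.card}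
  have hP : P.Nonempty := by
    obtain ⟨v, -⟩ := Finset.card_pos.1 (by omega : 0 < S.card)
    obtain ⟨w, hw⟩ := Set.ncard_eq_one.1 (D.leafEquiv.symm v).2
    have hadj : D.tree.Adj (D.leafEquiv.symm v) w := by
      rw [← mem_neighborSet, hw]; rfl
    rcases hor hadj with h | h
    · exact ⟨(_, _), hadj, h⟩
    · exact ⟨(_, _), hadj.symm, h⟩
  obtain ⟨⟨t, t'⟩, ⟨hadj, hlt⟩, hmax⟩ :=
    P.toFinite.exists_maximalFor (fun d => D.tree.edgeSide d.1 d.2) P hP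
  simp only at hadj hlt
  have hsmall : ∀ p, D.tree.Adj p t' → 3 * (S.filter (· ∈ D.shore p t')).card < S.card := by
    intro p hp
    by_cases hpt : p = t
    · rwa [hpt]
    -- If the side of `t'` away from `p` were light, it would properly contain the maximal light
    -- side.
    refine (hor hp).resolve_right fun h => ?_
    have hss := D.isTree.edgeSide_ssubset hadj hpt
    exact hss.2 (hmax (j := (t', p)) ⟨hp.symm, h⟩ hss.1)
  by_cases hleaf : t' ∈ treeLeaves D.tree
  -- A leaf `t'` holds at most one element of `S`, so the light side has at least `S.card - 1`,
  -- which is too many when `2 ≤ S.card`.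
  · have hone : (S.filter (· ∈ D.shore t' t)).card ≤ 1 := by
      refine Finset.card_le_one.2 ?_
      have key : ∀ v ∈ S.filter (· ∈ D.shore t' t), (D.leafEquiv.symm v : Fin D.size) = t' := by
        intro v hv
        by_contra hne
        obtain ⟨s, hs, hvs⟩ := D.isTree.connected.exists_mem_edgeSide hne
        obtain ⟨w, hw⟩ := Set.ncard_eq_one.1 hleaf
        have h1 : s ∈ D.tree.neighborSet t' := hs.symm
        have h2 : t ∈ D.tree.neighborSet t' := hadj.symm
        rw [hw, Set.mem_singleton_iff] at h1 h2
        rw [h1, ← h2] at hvs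
        exact D.isTree.disjoint_edgeSide hadj hvs (Finset.mem_filter.1 hv).2
      intro v hv w hw
      exact D.leafEquiv.symm.injective (Subtype.ext ((key v hv).trans (key w hw).symm))
    have := hsum hadj
    omega
  -- At an inner vertex three light sides would cover `S`.
  · obtain ⟨x, y, z, -, -, -, hxyz⟩ := Set.ncard_eq_three.1 (D.cubic t' hleaf)
    have hmem : ∀ s, D.tree.Adj s t' ↔ s = x ∨ s = y ∨ s = z := fun s => by
      rw [adj_comm, ← mem_neighborSet, hxyz]; simp
    have hx := hsmall x ((hmem x).2 (by simp))
    have hy := hsmall y ((hmem y).2 (by simp))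
    have hz := hsmall z ((hmem z).2 (by simp))
    have hcov : S ⊆ S.filter (· ∈ D.shore x t') ∪ S.filter (· ∈ D.shore y t') ∪
        S.filter (· ∈ D.shore z t') := by
      intro v hv
      have hne : (D.leafEquiv.symm v : Fin D.size) ≠ t' := fun h =>
        hleaf (h ▸ (D.leafEquiv.symm v).2)
      obtain ⟨s, hs, hvs⟩ := D.isTree.connected.exists_mem_edgeSide hne
      rw [← mem_shore] at hvs
      simp only [Finset.mem_union, Finset.mem_filter, hv, true_and]
      rcases (hmem s).1 hs with rfl | rfl | rfl <;> tauto
    have h1 := Finset.card_le_card hcov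
    have h2 := Finset.card_union_le (S.filter (· ∈ D.shore x t') ∪ S.filter (· ∈ D.shore y t'))
      (S.filter (· ∈ D.shore z t'))
    have h3 := Finset.card_union_le (S.filter (· ∈ D.shore x t')) (S.filter (· ∈ D.shore y t'))
    omega

end LeafDecomposition

/-- The tree on `Fin m` in which the parent of `v ≠ 0` is `v / 2`. -/
def heapTree (m : ℕ) : SimpleGraph (Fin m) where
  Adj u v := u ≠ v ∧ (u.val = v.val / 2 ∨ v.val = u.val / 2)
  symm := ⟨fun _ _ h => ⟨h.1.symm, h.2.symm⟩⟩
  loopless := ⟨fun _ h => h.1 rfl⟩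

lemma heapTree_adj {m : ℕ} {u v : Fin m} :
    (heapTree m).Adj u v ↔ u ≠ v ∧ (u.val = v.val / 2 ∨ v.val = u.val / 2) := Iff.rfl

/-- Repeated halving leads to `0`, and every edge is `{v, v / 2}` for some `v ≠ 0`, so there are at
most `m - 1` edges. -/
lemma heapTree_isTree {m : ℕ} (hm : 0 < m) : (heapTree m).IsTree := by
  have hroot : ∀ n (hn : n < m), (heapTree m).Reachable ⟨n, hn⟩ ⟨0, hm⟩ := by
    intro n
    induction n using Nat.strong_induction_on with
    | _ n ih =>
      intro hn
      rcases Nat.eq_zero_or_pos n with rfl | h0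
      · rfl
      · have hlt : n / 2 < n := by omega
        refine Reachable.trans (Adj.reachable ?_) (ih (n / 2) hlt (hlt.trans hn))
        exact heapTree_adj.2 ⟨by simp only [ne_eq, Fin.mk.injEq]; omega, .inr rfl⟩
  have hconn : (heapTree m).Connected := by
    have : Nonempty (Fin m) := ⟨⟨0, hm⟩⟩
    exact ⟨fun u v => (hroot u u.2).trans (hroot v v.2).symm⟩
  rw [isTree_iff_connected_and_card]
  refine ⟨hconn, le_antisymm ?_ hconn.card_vert_le_card_edgeSet_add_one⟩
  have hsub : (heapTree m).edgeSet ⊆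
      (fun v : Fin m => s(v, ⟨v.val / 2, by omega⟩)) '' {⟨0, hm⟩}ᶜ := by
    intro e
    induction e with
    | _ u v =>
      intro h
      obtain ⟨hne, h⟩ := heapTree_adj.1 h
      simp only at hne h
      have hne' : u.val ≠ v.val := fun h => hne (Fin.ext h)
      rcases h with h | h
      · refine ⟨v, fun hv => ?_, ?_⟩
        · have : v.val = 0 := congrArg Fin.val hv
          omega
        · exact Sym2.eq_iff.2 (.inr ⟨rfl, Fin.ext h.symm⟩)
      · refine ⟨u, fun hu => ?_, ?_⟩
        · have : u.val = 0 := congrArg Fin.val hu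
          omega
        · exact Sym2.eq_iff.2 (.inl ⟨rfl, Fin.ext h.symm⟩)
  have h1 := Set.ncard_le_ncard hsub
  have h2 := Set.ncard_image_le (f := fun v : Fin m => s(v, ⟨v.val / 2, by omega⟩))
    (s := {⟨0, hm⟩}ᶜ) (Set.toFinite _)
  have h3 := Set.ncard_add_ncard_compl ({⟨0, hm⟩} : Set (Fin m))
  rw [Set.ncard_singleton] at h3
  rw [Nat.card_coe_set_eq]
  omega

lemma mem_treeLeaves_heapTree {n : ℕ} (hn : 2 ≤ n) {v : Fin (2 * n - 2)}
    (hv : v.val = 0 ∨ n - 1 ≤ v.val) : v ∈ treeLeaves (heapTree (2 * n - 2)) := by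
  refine Set.ncard_eq_one.2 ⟨if v.val = 0 then ⟨1, by omega⟩ else ⟨v.val / 2, by omega⟩, ?_⟩
  ext w
  simp only [mem_neighborSet, heapTree_adj, Set.mem_singleton_iff, ne_eq, Fin.ext_iff]
  have := w.2
  split_ifs with h0 <;> simp only <;> omega

lemma ncard_neighborSet_heapTree {n : ℕ} {v : Fin (2 * n - 2)}
    (hv : v.val ≠ 0) (hv' : v.val < n - 1) :
    ((heapTree (2 * n - 2)).neighborSet v).ncard = 3 := by
  refine Set.ncard_eq_three.2
    ⟨⟨v.val / 2, by omega⟩, ⟨2 * v.val, by omega⟩, ⟨2 * v.val + 1, by omega⟩, ?_, ?_, ?_, ?_⟩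
  · simp only [ne_eq, Fin.mk.injEq]; omega
  · simp only [ne_eq, Fin.mk.injEq]; omega
  · simp only [ne_eq, Fin.mk.injEq]; omega
  ext w
  simp only [mem_neighborSet, heapTree_adj, Set.mem_insert_iff, Set.mem_singleton_iff, ne_eq,
    Fin.ext_iff]
  omega

lemma treeLeaves_heapTree {n : ℕ} (hn : 2 ≤ n) :
    treeLeaves (heapTree (2 * n - 2)) = {v | v.val = 0 ∨ n - 1 ≤ v.val} := by
  ext v
  refine ⟨fun h => ?_, mem_treeLeaves_heapTree hn⟩
  by_contra hv
  simp only [Set.mem_ofPred_eq, not_or, not_le] at hv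
  have h' : ((heapTree (2 * n - 2)).neighborSet v).ncard = 1 := h
  rw [ncard_neighborSet_heapTree hv.1 hv.2] at h'
  omega

lemma card_treeLeaves_heapTree {n : ℕ} (hn : 2 ≤ n) :
    Nat.card (treeLeaves (heapTree (2 * n - 2))) = n := by
  rw [treeLeaves_heapTree hn]
  let f : Fin n → {v : Fin (2 * n - 2) | v.val = 0 ∨ n - 1 ≤ v.val} := fun i =>
    if h : i.val = 0 then ⟨⟨0, by omega⟩, .inl rfl⟩
    else ⟨⟨n - 2 + i.val, by omega⟩, .inr (by simp only; omega)⟩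
  have hf : Function.Bijective f := by
    constructor
    · intro i i' h
      simp only [f] at h
      split_ifs at h <;> simp only [Subtype.mk.injEq, Fin.mk.injEq] at h <;> (apply Fin.ext; omega)
    · rintro ⟨v, hv⟩
      by_cases h0 : v.val = 0
      · refine ⟨⟨0, by omega⟩, ?_⟩
        simp only [f, dite_true, Subtype.mk.injEq, Fin.ext_iff]
        exact h0.symm
      · have h1 := hv.resolve_left h0
        refine ⟨⟨v.val - (n - 2), by omega⟩, ?_⟩
        simp only [f]
        rw [dif_neg (by omega)]
        simp only [Subtype.mk.injEq, Fin.ext_iff]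
        omega
  rw [← Nat.card_congr (Equiv.ofBijective f hf), Nat.card_eq_fintype_card, Fintype.card_fin]

/-- In the heap tree on `2 * n - 2` vertices, `0` has the single child `1`, the vertices from `1` to
`n - 2` have a parent and two children, and the last `n - 1` vertices have no child. This gives
exactly `n` leaves. -/
lemma LeafDecomposition.nonempty {V : Type*} [Finite V] (hV : 2 ≤ Nat.card V) :
    Nonempty (LeafDecomposition V) := by
  have hcard := card_treeLeaves_heapTree hV
  exact ⟨{
    size := 2 * Nat.card V - 2
    tree := heapTree _
    isTree := heapTree_isTree (by omega)
    cubic := fun t ht => by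
      rw [treeLeaves_heapTree hV] at ht
      simp only [Set.mem_ofPred_eq, not_or, not_le] at ht
      exact ncard_neighborSet_heapTree ht.1 ht.2
    leafEquiv := (Finite.card_eq.1 hcard).some }⟩

/-! ### Matching porosity and perfect matching width -/

section Porosity

variable {V : Type*} (G : SimpleGraph V)

lemma ncard_le_matchingPorosity [Finite V] {M : G.Subgraph} (hM : M.IsPerfectMatching) (X : Set V) :
    (M.edgeSet ∩ edgeCut G X).ncard ≤ matchingPorosity G X := by
  refine le_csSup ⟨(Set.univ : Set (Sym2 V)).ncard, ?_⟩ ⟨M, hM, rfl⟩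
  rintro _ ⟨M, -, rfl⟩
  exact Set.ncard_le_ncard (Set.subset_univ _)

lemma IsMatchingCovered.matchingPorosity_pos [Finite V] {G : SimpleGraph V} (hG : IsMatchingCovered G)
    {X : Set V} {x y : V} (hx : x ∈ X) (hy : y ∉ X) : 0 < matchingPorosity G X := by
  obtain ⟨p⟩ := hG.1.preconnected x y
  obtain ⟨d, -, hd, hd'⟩ := p.exists_boundary_dart X hx hy
  obtain ⟨M, hM, hdM⟩ := hG.2 d.edge d.edge_mem
  refine lt_of_lt_of_le ?_ (ncard_le_matchingPorosity G hM X)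
  exact (Set.ncard_pos (Set.toFinite _)).2 ⟨d.edge, hdM, d.fst, hd, d.snd, hd', d.adj, rfl⟩

lemma LeafDecomposition.matchingPorosity_le_matchingWidth (D : LeafDecomposition V)
    {t t' : Fin D.size} (h : D.tree.Adj t t') :
    matchingPorosity G (D.shore t t') ≤ D.matchingWidth G := by
  refine le_csSup (Set.Finite.bddAbove ?_) ⟨t, t', h, rfl⟩
  refine (Set.finite_range fun d : Fin D.size × Fin D.size =>
    matchingPorosity G (D.shore d.1 d.2)).subset ?_
  rintro _ ⟨t, t', -, rfl⟩
  exact ⟨(t, t'), rfl⟩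

open Classical in
/-- Every set of at least two vertices is split evenly, up to a factor of two, by a cut whose
porosity is at most the perfect matching width. -/
lemma exists_balanced_matchingPorosity_le [Finite V] (S : Finset V) (hS : 2 ≤ S.card) :
    ∃ X : Set V, S.card ≤ 3 * (S.filter (· ∈ X)).card ∧ S.card ≤ 3 * (S.filter (· ∉ X)).card ∧
      matchingPorosity G X ≤ perfectMatchingWidth G := by
  have hV : 2 ≤ Nat.card V := by
    refine hS.trans ?_
    rw [← Set.ncard_coe_finset, ← Set.ncard_univ]
    exact Set.ncard_le_ncard (Set.subset_univ _)
  obtain ⟨D₀⟩ := LeafDecomposition.nonempty hV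
  -- The infimum is attained only because some decomposition exists; over the empty set it would be
  -- `0`.
  obtain ⟨D, hD⟩ : perfectMatchingWidth G ∈
      {w | ∃ D : LeafDecomposition V, w = D.matchingWidth G} := Nat.sInf_mem ⟨_, D₀, rfl⟩
  obtain ⟨t, t', h, h1, h2⟩ := D.exists_balanced S hS
  exact ⟨D.shore t t', h1, h2, hD ▸ D.matchingPorosity_le_matchingWidth G h⟩

end Porosity

/-! ### Perfect matchings from permutations -/

section Perm

variable {Q V : Type*} (e : Q ⊕ Q ≃ V) (G : SimpleGraph V) (σ : Equiv.Perm Q)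

/-- The perfect matching that joins the first copy of every `q` to the second copy of `σ q`. -/
def permMatching (h : ∀ q, G.Adj (e (.inl q)) (e (.inr (σ q)))) : G.Subgraph where
  verts := Set.univ
  Adj v w := ∃ q, s(v, w) = s(e (.inl q), e (.inr (σ q)))
  adj_sub := by
    rintro v w ⟨q, hq⟩
    rw [← mem_edgeSet, hq]
    exact h q
  edge_vert := fun _ => Set.mem_univ _
  symm := ⟨by
    rintro v w ⟨q, hq⟩
    exact ⟨q, Sym2.eq_swap.trans hq⟩⟩

lemma mem_edgeSet_permMatching (h : ∀ q, G.Adj (e (.inl q)) (e (.inr (σ q))))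
    {x : Sym2 V} : x ∈ (permMatching e G σ h).edgeSet ↔
      ∃ q, x = s(e (.inl q), e (.inr (σ q))) := by
  induction x with
  | _ v w => exact Iff.rfl

lemma permMatching_isPerfectMatching (h : ∀ q, G.Adj (e (.inl q)) (e (.inr (σ q)))) :
    (permMatching e G σ h).IsPerfectMatching := by
  refine ⟨fun v _ => ?_, fun v => Set.mem_univ v⟩
  obtain ⟨q | q, rfl⟩ := e.surjective v
  · refine ⟨e (.inr (σ q)), ⟨q, rfl⟩, ?_⟩
    rintro w ⟨p, hp⟩
    rcases Sym2.eq_iff.1 hp with ⟨h1, rfl⟩ | ⟨h1, rfl⟩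
    · rw [Sum.inl.inj (e.injective h1)]
    · exact absurd (e.injective h1) Sum.inl_ne_inr
  · refine ⟨e (.inl (σ.symm q)), ⟨σ.symm q, by rw [σ.apply_symm_apply, Sym2.eq_swap]⟩, ?_⟩
    rintro w ⟨p, hp⟩
    rcases Sym2.eq_iff.1 hp with ⟨h1, rfl⟩ | ⟨h1, rfl⟩
    · exact absurd (e.injective h1) Sum.inr_ne_inl
    · rw [Sum.inr.inj (e.injective h1), σ.symm_apply_apply]

lemma card_le_matchingPorosity [Finite V]
    (h : ∀ q, G.Adj (e (.inl q)) (e (.inr (σ q)))) (X : Set V) {ι : Type*} (s : Finset ι) (f : ι → Q)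
    (hf : Set.InjOn f s)
    (hc : ∀ i ∈ s, ¬ (e (.inl (f i)) ∈ X ↔ e (.inr (σ (f i))) ∈ X)) :
    s.card ≤ matchingPorosity G X := by
  refine le_trans ?_ (ncard_le_matchingPorosity G (permMatching_isPerfectMatching e G σ h) X)
  rw [← Set.ncard_coe_finset]
  refine Set.ncard_le_ncard_of_injOn (fun i => s(e (.inl (f i)), e (.inr (σ (f i))))) ?_ ?_
  · intro i hi
    refine ⟨(mem_edgeSet_permMatching ..).2 ⟨f i, rfl⟩, ?_⟩
    by_cases hX : e (.inl (f i)) ∈ X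
    · exact ⟨_, hX, _, fun hX' => hc i hi (by tauto), h _, rfl⟩
    · exact ⟨e (.inr (σ (f i))), by have := hc i hi; tauto, _, hX, (h _).symm, Sym2.eq_swap⟩
  · intro i hi j hj hij
    rcases Sym2.eq_iff.1 hij with ⟨h1, -⟩ | ⟨h1, -⟩
    · exact hf hi hj (Sum.inl.inj (e.injective h1))
    · exact absurd (e.injective h1) Sum.inl_ne_inr

end Perm

/-! ### Bipartite graphs with a perfect matching and their `M`-directions -/

section Direction

variable {V : Type*} {G : SimpleGraph V} {A : Set V} {M : G.Subgraph}

lemma exists_equiv_of_isPerfectMatching (hA : G.IsBipartiteWith A Aᶜ)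
    (hM : M.IsPerfectMatching) :
    ∃ e : M.edgeSet ⊕ M.edgeSet ≃ V, (∀ q, e (.inl q) ∈ A) ∧ (∀ q, e (.inr q) ∉ A) ∧
      ∀ q : M.edgeSet, (q : Sym2 V) = s(e (.inl q), e (.inr q)) := by
  have hends : ∀ q : M.edgeSet, ∃ a b, a ∈ A ∧ b ∉ A ∧ (q : Sym2 V) = s(a, b) := by
    rintro ⟨q, hq⟩
    induction q with
    | _ v w =>
      rcases hA.mem_of_adj (M.adj_sub hq) with ⟨h1, h2⟩ | ⟨h1, h2⟩
      · exact ⟨v, w, h1, h2, rfl⟩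
      · exact ⟨w, v, h2, h1, Sym2.eq_swap⟩
  choose a b ha hb hab using hends
  have hadj : ∀ q, M.Adj (a q) (b q) := fun q => by
    have := q.2
    rwa [hab q] at this
  have hinj : Function.Injective (Sum.elim a b) := by
    rintro (q | q) (p | p) h
    · have h' : a q = a p := h
      have : b q = b p := hM.1.eq_of_adj_left (hadj q) (h' ▸ hadj p)
      exact congrArg _ (Subtype.ext (by rw [hab, hab, h', this]))
    · have h' : a q = b p := h
      exact absurd (h' ▸ ha q) (hb p)
    · have h' : b q = a p := h
      exact absurd (h' ▸ ha p) (hb q)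
    · have h' : b q = b p := h
      have : a q = a p := hM.1.eq_of_adj_right (hadj q) (h' ▸ hadj p)
      exact congrArg _ (Subtype.ext (by rw [hab, hab, h', this]))
  have hsurj : Function.Surjective (Sum.elim a b) := by
    intro v
    obtain ⟨w, hw, -⟩ := hM.1 (hM.2 v)
    have h := hab ⟨s(v, w), hw⟩
    rcases Sym2.eq_iff.1 h with ⟨h1, -⟩ | ⟨h1, -⟩
    · exact ⟨.inl _, h1.symm⟩
    · exact ⟨.inr _, h1.symm⟩
  exact ⟨Equiv.ofBijective _ ⟨hinj, hsurj⟩, ha, hb, hab⟩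

/-- Provides coordinates on `G` in which the vertices are two copies of those of `D`. Adjacency is
needed in this direction only, since the lower bound merely has to produce perfect matchings. -/
lemma exists_equiv_of_matchingDirection {Q : Type*} {D : Digraph Q}
    (hA : G.IsBipartiteWith A Aᶜ) (hM : M.IsPerfectMatching)
    (φ : (matchingDirection G A M).Adj ≃r D.Adj) :
    ∃ e : Q ⊕ Q ≃ V, ∀ q q', q = q' ∨ D.Adj q q' → G.Adj (e (.inl q)) (e (.inr q')) := by
  obtain ⟨e, ha, hb, hab⟩ := exists_equiv_of_isPerfectMatching hA hM
  refine ⟨(Equiv.sumCongr φ.symm.toEquiv φ.symm.toEquiv).trans e, fun q q' h => ?_⟩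
  change G.Adj (e (.inl (φ.symm q))) (e (.inr (φ.symm q')))
  rcases h with rfl | h
  · have h1 := (φ.symm q).2
    rw [hab (φ.symm q)] at h1
    exact M.adj_sub h1
  · obtain ⟨-, a, haA, b, hbA, haq, hbq, h⟩ := φ.symm.map_rel_iff.2 h
    rw [hab, Sym2.mem_iff] at haq hbq
    rcases haq with rfl | rfl
    · rcases hbq with rfl | rfl
      · exact absurd (ha _) hbA
      · exact h
    · exact absurd haA (hb _)

end Direction

/-! ### Splitting a digraph into a bipartite graph -/

section Split

variable {Q V : Type*} (e : Q ⊕ Q ≃ V) (D : Digraph Q)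

/-- The bipartite graph obtained from a digraph by splitting every vertex into two adjacent
copies. -/
def splitGraph : SimpleGraph V where
  Adj v w := ∃ q q', (q = q' ∨ D.Adj q q') ∧ s(v, w) = s(e (.inl q), e (.inr q'))
  symm := ⟨by
    rintro v w ⟨q, q', h, hq⟩
    exact ⟨q, q', h, Sym2.eq_swap.trans hq⟩⟩
  loopless := ⟨by
    rintro v ⟨q, q', -, hq⟩
    have := Sym2.eq_iff.1 hq
    have : e (.inl q) = e (.inr q') := by rcases this with ⟨h1, h2⟩ | ⟨h1, h2⟩ <;> rw [← h1, ← h2]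
    exact Sum.inl_ne_inr (e.injective this)⟩

lemma splitGraph_adj {q q' : Q} :
    (splitGraph e D).Adj (e (.inl q)) (e (.inr q')) ↔ q = q' ∨ D.Adj q q' := by
  refine ⟨?_, fun h => ⟨q, q', h, rfl⟩⟩
  rintro ⟨p, p', h, hp⟩
  rcases Sym2.eq_iff.1 hp with ⟨h1, h2⟩ | ⟨h1, -⟩
  · rwa [Sum.inl.inj (e.injective h1), Sum.inr.inj (e.injective h2)]
  · exact absurd (e.injective h1) Sum.inl_ne_inr

variable {D}

/-- An edge between the two copies of one vertex lies in the identity matching, any other edge in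
the matching of a permutation that uses its arc. -/
lemma splitGraph_isMatchingCovered [Nonempty Q]
    (hperm : ∀ q q', D.Adj q q' → ∃ σ : Equiv.Perm Q, (∀ p, p = σ p ∨ D.Adj p (σ p)) ∧ σ q = q')
    (hconn : ∀ q q', Relation.EqvGen D.Adj q q') : IsMatchingCovered (splitGraph e D) := by
  have hself : ∀ q, (splitGraph e D).Reachable (e (.inl q)) (e (.inr q)) := fun q =>
    Adj.reachable ((splitGraph_adj e D).2 (.inl rfl))
  have hinl : ∀ q q', (splitGraph e D).Reachable (e (.inl q)) (e (.inl q')) := by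
    intro q q'
    induction hconn q q' with
    | rel q q' h =>
      exact (Adj.reachable ((splitGraph_adj e D).2 (.inr h))).trans (hself q').symm
    | refl => rfl
    | symm _ _ _ ih => exact ih.symm
    | trans _ _ _ _ _ ih ih' => exact ih.trans ih'
  obtain ⟨q₀⟩ := ‹Nonempty Q›
  have hbase : ∀ v, (splitGraph e D).Reachable v (e (.inl q₀)) := by
    intro v
    obtain ⟨q | q, rfl⟩ := e.surjective v
    · exact hinl q q₀
    · exact (hself q).symm.trans (hinl q q₀)
  have : Nonempty V := ⟨e (.inl q₀)⟩
  refine ⟨⟨fun v w => (hbase v).trans (hbase w).symm⟩, fun x => ?_⟩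
  induction x with
  | _ v w =>
    rintro ⟨q, q', h, hx⟩
    rw [hx]
    obtain ⟨σ, hσ, hq⟩ : ∃ σ : Equiv.Perm Q, (∀ p, p = σ p ∨ D.Adj p (σ p)) ∧ σ q = q' := by
      rcases h with rfl | h
      · exact ⟨1, fun _ => .inl rfl, rfl⟩
      · exact hperm q q' h
    have hadj := fun p => (splitGraph_adj e D).2 (hσ p)
    exact ⟨permMatching e _ σ hadj, permMatching_isPerfectMatching ..,
      (mem_edgeSet_permMatching ..).2 ⟨q, by rw [hq]⟩⟩

lemma splitGraph_isBipartiteWith :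
    (splitGraph e D).IsBipartiteWith (Set.range fun q => e (.inl q))
      (Set.range fun q => e (.inl q))ᶜ := by
  have hr : ∀ q, e (.inr q) ∈ (Set.range fun q => e (.inl q))ᶜ := by
    rintro q ⟨p, hp⟩
    exact Sum.inl_ne_inr (e.injective hp)
  refine ⟨disjoint_compl_right, ?_⟩
  rintro v w ⟨q, q', -, hq⟩
  rcases Sym2.eq_iff.1 hq with ⟨rfl, rfl⟩ | ⟨rfl, rfl⟩
  · exact .inl ⟨⟨q, rfl⟩, hr q'⟩
  · exact .inr ⟨hr q', ⟨q, rfl⟩⟩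

lemma exists_matchingDirection_splitGraph (hD : ∀ q, ¬ D.Adj q q) :
    ∃ M : (splitGraph e D).Subgraph, M.IsPerfectMatching ∧
      Nonempty ((matchingDirection (splitGraph e D) (Set.range fun q => e (.inl q)) M).Adj ≃r
        D.Adj) := by
  have hadj : ∀ q, (splitGraph e D).Adj (e (.inl q)) (e (.inr ((1 : Equiv.Perm Q) q))) :=
    fun q => (splitGraph_adj e D).2 (.inl rfl)
  refine ⟨permMatching e _ 1 hadj, permMatching_isPerfectMatching .., ?_⟩
  let f : Q → (permMatching e _ 1 hadj).edgeSet := fun q =>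
    ⟨s(e (.inl q), e (.inr q)), (mem_edgeSet_permMatching ..).2 ⟨q, rfl⟩⟩
  have hf : Function.Bijective f := by
    constructor
    · intro q p h
      rcases Sym2.eq_iff.1 (congrArg Subtype.val h) with ⟨h1, -⟩ | ⟨h1, -⟩
      · exact Sum.inl.inj (e.injective h1)
      · exact absurd (e.injective h1) Sum.inl_ne_inr
    · rintro ⟨x, hx⟩
      obtain ⟨q, rfl⟩ := (mem_edgeSet_permMatching ..).1 hx
      exact ⟨q, rfl⟩
  refine ⟨RelIso.symm ⟨Equiv.ofBijective f hf, ?_⟩⟩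
  intro q q'
  change (f q ≠ f q' ∧ _) ↔ _
  constructor
  · rintro ⟨hne, a, ⟨p, rfl⟩, b, hb, haq, hbq, h⟩
    have hpq : p = q := by
      rcases Sym2.mem_iff.1 haq with h1 | h1
      · exact Sum.inl.inj (e.injective h1)
      · exact absurd (e.injective h1) Sum.inl_ne_inr
    have hbq' : b = e (.inr q') := by
      rcases Sym2.mem_iff.1 hbq with h1 | h1
      · exact absurd ⟨q', h1.symm⟩ hb
      · exact h1
    subst hpq hbq'
    exact ((splitGraph_adj e D).1 h).resolve_left fun hpq => hne (hpq ▸ rfl)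
  · intro h
    refine ⟨fun hq => hD q (by rwa [← hf.1 hq] at h), e (.inl q), ⟨q, rfl⟩, e (.inr q'), ?_,
      Sym2.mem_mk_left .., Sym2.mem_mk_right .., (splitGraph_adj e D).2 (.inr h)⟩
    rintro ⟨p, hp⟩
    exact Sum.inl_ne_inr (e.injective hp)

end Split

/-! ### The contracted cylindrical grid -/

/-- The vertices of the cylindrical grid of order `k`. -/
abbrev GridVertex (k : ℕ) := Fin k × ZMod (2 * k)

/-- The vertices of the digraph obtained from the cylindrical grid by contracting `E`. -/
abbrev ContractedVertex {k : ℕ} (E : Set (GridVertex k × GridVertex k)) :=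
  Quot fun u v : GridVertex k => (u, v) ∈ E

namespace GridVertex

variable {k : ℕ}

/-- The successor of a vertex on its concentric cycle. -/
def succ (u : GridVertex k) : GridVertex k := (u.1, u.2 + 1)

/-- The arcs of the radial paths of the cylindrical grid. -/
def RadialArc (u v : GridVertex k) : Prop :=
  (v.2 = u.2 ∧ Even u.2.val ∧ v.1.val = u.1.val + 1) ∨
    (v.2 = u.2 ∧ Odd u.2.val ∧ u.1.val = v.1.val + 1)

/-- The vertices of the innermost and of the outermost cycle. -/
def IsEnd (u : GridVertex k) : Prop := u.1.val = 0 ∨ u.1.val + 1 = k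

lemma succ_injective : Function.Injective (succ : GridVertex k → GridVertex k) := by
  rintro ⟨i, j⟩ ⟨i', j'⟩ h
  simpa [succ] using h

end GridVertex

open GridVertex

lemma cylindricalGrid_adj {k : ℕ} {u v : GridVertex k} :
    (cylindricalGrid k).Adj u v ↔ v = u.succ ∨ RadialArc u v :=
  or_congr (Prod.ext_iff (x := v) (y := u.succ)).symm Iff.rfl

lemma ZMod.val_add_one_mod_two {k : ℕ} [NeZero k] (j : ZMod (2 * k)) :
    (j + 1).val % 2 = (j.val + 1) % 2 := by
  have : Fact (1 < 2 * k) := ⟨by have := NeZero.pos k; omega⟩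
  rw [ZMod.val_add, ZMod.val_one, Nat.mod_mod_of_dvd _ (dvd_mul_right 2 k)]

lemma ZMod.induction_add_one {n : ℕ} [NeZero n] {P : ZMod n → Prop} (h0 : P 0)
    (hs : ∀ j, P j → P (j + 1)) (j : ZMod n) : P j := by
  rw [← ZMod.natCast_zmod_val j]
  induction j.val with
  | zero => simpa using h0
  | succ m ih => simpa using hs _ ih

/-- Contraction sets that consist of every second arc of the innermost and of the outermost
cycle. -/
structure IsEndContraction {k : ℕ} (E : Set (GridVertex k × GridVertex k)) : Prop where
  eq_succ {u v : GridVertex k} : (u, v) ∈ E → v = u.succ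
  isEnd {u v : GridVertex k} : (u, v) ∈ E → u.IsEnd
  alternate (u : GridVertex k) : u.IsEnd → ((u.succ, u.succ.succ) ∈ E ↔ (u, u.succ) ∉ E)

lemma IsEverySecondArc.eq_succ {k : ℕ} {i : Fin k} {E : Set (GridVertex k × GridVertex k)}
    (hE : IsEverySecondArc i E) {u v : GridVertex k} (h : (u, v) ∈ E) :
    u.1 = i ∧ v = u.succ := by
  obtain ⟨j, hj⟩ := hE.1 _ h
  obtain ⟨rfl, rfl⟩ := Prod.mk.inj hj
  exact ⟨rfl, rfl⟩

/-- For `2 ≤ k` the two end cycles are distinct, so neither contraction set disturbs the alternation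
of the other. -/
lemma isEndContraction_union {k : ℕ} (hk : 2 ≤ k) {a b : Fin k} (ha : a.val + 1 = k)
    (hb : b.val = 0) {Eo Ei : Set (GridVertex k × GridVertex k)} (hEo : IsEverySecondArc a Eo)
    (hEi : IsEverySecondArc b Ei) : IsEndContraction (Eo ∪ Ei) where
  eq_succ := by
    rintro u v (h | h)
    · exact (hEo.eq_succ h).2
    · exact (hEi.eq_succ h).2
  isEnd := by
    rintro u v (h | h)
    · exact .inr ((hEo.eq_succ h).1 ▸ ha)
    · exact .inl ((hEi.eq_succ h).1 ▸ hb)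
  alternate := by
    rintro ⟨i, j⟩ h
    have hab : a ≠ b := fun h => by rw [h] at ha; omega
    have hno : ∀ {j v}, ((b, j), v) ∉ Eo := fun h => hab (hEo.eq_succ h).1.symm
    have hni : ∀ {j v}, ((a, j), v) ∉ Ei := fun h => hab (hEi.eq_succ h).1
    rcases h with h | h
    · obtain rfl : i = b := Fin.ext (h.trans hb.symm)
      simpa [hno, GridVertex.succ, cycleArc] using hEi.2 j
    · obtain rfl : i = a := Fin.ext (by simp only at h; omega)
      simpa [hni, GridVertex.succ, cycleArc] using hEo.2 j

/-! ### Contraction classes and permutations along arcs -/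

namespace IsEndContraction

variable {k : ℕ} {E : Set (GridVertex k × GridVertex k)}

open Classical in
/-- The representative of the class of `u` whose arc on its concentric cycle is not contracted. -/
noncomputable def retract (E : Set (GridVertex k × GridVertex k)) (u : GridVertex k) :
    GridVertex k :=
  if (u, u.succ) ∈ E then u.succ else u

lemma retract_fst (u : GridVertex k) : (retract E u).1 = u.1 := by
  unfold retract
  split_ifs <;> rfl

lemma mk_retract (u : GridVertex k) :
    (Quot.mk _ (retract E u) : ContractedVertex E) = Quot.mk _ u := by
  unfold retract
  split_ifs with h
  · exact (Quot.sound h).symm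
  · rfl

lemma valid_of_adj {u v : GridVertex k} (h : (cylindricalGrid k).Adj u v) :
    (Quot.mk _ u : ContractedVertex E) = Quot.mk _ v ∨
      (contractArcs (cylindricalGrid k) E).Adj (Quot.mk _ u) (Quot.mk _ v) :=
  or_iff_not_imp_left.2 fun hne => ⟨hne, u, v, rfl, rfl, h⟩

variable (hE : IsEndContraction E)

include hE

lemma not_mem_of_not_succ_mem {u v : GridVertex k} (h : (u, u.succ) ∉ E) : (u, v) ∉ E :=
  fun h' => h (hE.eq_succ h' ▸ h')

lemma not_succ_mem {u : GridVertex k} (h : (u, u.succ) ∈ E) : (u.succ, u.succ.succ) ∉ E :=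
  fun h' => (hE.alternate u (hE.isEnd h)).1 h' h

lemma not_retract_mem (u : GridVertex k) : (retract E u, (retract E u).succ) ∉ E := by
  unfold retract
  split_ifs with h
  · exact hE.not_succ_mem h
  · exact h

lemma retract_eq {u v : GridVertex k}
    (h : (Quot.mk _ u : ContractedVertex E) = Quot.mk _ v) : retract E u = retract E v := by
  refine congrArg (Quot.lift (retract E) fun u v huv => ?_) h
  obtain rfl := hE.eq_succ huv
  rw [retract, retract, if_pos huv, if_neg (hE.not_succ_mem huv)]

/-- Contracted arcs are pairwise disjoint by alternation, so `retract` is a normal form and a class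
has at most two members. -/
lemma eq_or_of_mk_eq {u v : GridVertex k}
    (h : (Quot.mk _ u : ContractedVertex E) = Quot.mk _ v) :
    u = v ∨ (u, v) ∈ E ∨ (v, u) ∈ E := by
  have h := hE.retract_eq h
  unfold retract at h
  split_ifs at h with h1 h2 h2
  · exact .inl (succ_injective h)
  · exact .inr (.inl (h ▸ h1))
  · exact .inr (.inr (h ▸ h2))
  · exact .inl h

lemma fst_eq_of_mk_eq {u v : GridVertex k}
    (h : (Quot.mk _ u : ContractedVertex E) = Quot.mk _ v) : u.1 = v.1 := by
  rw [← retract_fst (E := E) u, hE.retract_eq h, retract_fst]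

lemma exists_rep (q : ContractedVertex E) :
    ∃ u : GridVertex k, (u, u.succ) ∉ E ∧ Quot.mk _ u = q := by
  obtain ⟨u, rfl⟩ := Quot.exists_rep q
  exact ⟨retract E u, hE.not_retract_mem u, mk_retract u⟩

/-- The permutation that moves all vertices of the concentric cycles in `I` one step forward. -/
lemma exists_perm_rotate [NeZero k] (I : Set (Fin k)) :
    ∃ σ : Equiv.Perm (ContractedVertex E),
      (∀ q, q = σ q ∨ (contractArcs (cylindricalGrid k) E).Adj q (σ q)) ∧
      (∀ u : GridVertex k, u.1 ∈ I → (u, u.succ) ∉ E → σ (Quot.mk _ u) = Quot.mk _ u.succ) ∧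
      ∀ u : GridVertex k, u.1 ∉ I → σ (Quot.mk _ u) = Quot.mk _ u := by
  classical
  choose r hr hrq using hE.exists_rep
  have hrow : ∀ u : GridVertex k, (r (Quot.mk _ u)).1 = u.1 := fun u =>
    hE.fst_eq_of_mk_eq (hrq _)
  -- Each class leaves through its unique member whose outgoing cycle arc is not contracted.
  let f : ContractedVertex E → ContractedVertex E := fun q =>
    if (r q).1 ∈ I then Quot.mk _ (r q).succ else q
  have hfrow : ∀ q, (r (f q)).1 = (r q).1 := by
    intro q
    by_cases h : (r q).1 ∈ I
    · simp only [f, if_pos h]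
      exact hrow _
    · simp only [f, if_neg h]
  have hinj : Function.Injective f := by
    intro q p h
    have hqp : (r q).1 = (r p).1 := by rw [← hfrow q, h, hfrow]
    by_cases hI : (r q).1 ∈ I
    · simp only [f, if_pos hI, if_pos (hqp ▸ hI)] at h
      have key : (r q).succ = (r p).succ := by
        rcases hE.eq_or_of_mk_eq h with h | h | h
        · exact h
        · have := succ_injective (hE.eq_succ h)
          exact absurd (this ▸ hE.eq_succ h ▸ h) (hr p)
        · have := succ_injective (hE.eq_succ h)
          exact absurd (this ▸ hE.eq_succ h ▸ h) (hr q)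
      rw [← hrq q, ← hrq p, succ_injective key]
    · simpa only [f, if_neg hI, if_neg (hqp ▸ hI)] using h
  refine ⟨Equiv.ofBijective f (Finite.injective_iff_bijective.1 hinj), fun q => ?_,
    fun u hu hu' => ?_, fun u hu => ?_⟩
  · change q = f q ∨ _
    by_cases h : (r q).1 ∈ I
    · have := valid_of_adj (E := E) (cylindricalGrid_adj.2 (.inl (rfl : (r q).succ = _)))
      rw [hrq] at this
      simpa only [Equiv.ofBijective_apply, f, if_pos h] using this
    · exact .inl (by simp only [f, if_neg h])
  · have hru : r (Quot.mk _ u) = u := by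
      rcases hE.eq_or_of_mk_eq (hrq (Quot.mk _ u)) with h | h | h
      · exact h
      · exact absurd h (hE.not_mem_of_not_succ_mem (hr _))
      · exact absurd h (hE.not_mem_of_not_succ_mem hu')
    simp only [Equiv.ofBijective_apply, f, hru, if_pos hu]
  · simp only [Equiv.ofBijective_apply, f, hrow, if_neg hu]

/-- On an end cycle all tails of radial arcs lie in columns of one parity, while a contracted arc
joins columns of opposite parity. -/
lemma tails_not_mem [NeZero k] {u v u' v' : GridVertex k} (h : RadialArc u v)
    (h' : RadialArc u' v') : (u, u') ∉ E := by
  intro hu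
  have h1 := hE.isEnd hu
  obtain rfl := hE.eq_succ hu
  have h2 := ZMod.val_add_one_mod_two u.2
  have := v.1.2
  have := v'.1.2
  simp only [RadialArc, IsEnd, GridVertex.succ, Nat.even_iff, Nat.odd_iff] at *
  omega

lemma heads_not_mem [NeZero k] {u v u' v' : GridVertex k} (h : RadialArc u v)
    (h' : RadialArc u' v') : (v, v') ∉ E := by
  intro hu
  have h1 := hE.isEnd hu
  obtain rfl := hE.eq_succ hu
  have h2 := ZMod.val_add_one_mod_two v.2
  have := u.1.2
  have := u'.1.2
  simp only [RadialArc, IsEnd, GridVertex.succ, Nat.even_iff, Nat.odd_iff] at *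
  have h3 : v.2.val = u.2.val := by rcases h with h | h <;> rw [h.1]
  have h4 : (v.2 + 1).val = u'.2.val := by rcases h' with h | h <;> rw [h.1]
  omega

lemma tail_eq_of_mk_eq [NeZero k] {u v u' v' : GridVertex k} (h : RadialArc u v)
    (h' : RadialArc u' v') (huu : (Quot.mk _ u : ContractedVertex E) = Quot.mk _ u') : u = u' :=
  (hE.eq_or_of_mk_eq huu).resolve_right fun hor =>
    hor.elim (hE.tails_not_mem h h') (hE.tails_not_mem h' h)

/-- A vertex without an outgoing radial arc lies on an end cycle in a column of the wrong parity;
alternation merges it with a neighbour in a column of the right parity. -/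
lemma exists_radialArc [NeZero k] (hk : 2 ≤ k) (q : ContractedVertex E) :
    ∃ u v : GridVertex k, RadialArc u v ∧ Quot.mk _ u = q := by
  have key : ∀ u : GridVertex k, (∃ v, RadialArc u v) ∨ u.IsEnd ∧
      ∀ w : GridVertex k, w.1 = u.1 → w.2.val % 2 = (u.2.val + 1) % 2 →
        ∃ v, RadialArc w v := by
    rintro ⟨i, j⟩
    have hi := i.2
    have hout : ∀ j : ZMod (2 * k), j.val % 2 = 0 → i.val + 1 < k → ∃ v, RadialArc (i, j) v :=
      fun j hj h => ⟨(⟨i.val + 1, h⟩, j), .inl ⟨rfl, Nat.even_iff.2 hj, rfl⟩⟩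
    have hin : ∀ j : ZMod (2 * k), j.val % 2 = 1 → 0 < i.val → ∃ v, RadialArc (i, j) v :=
      fun j hj h => ⟨(⟨i.val - 1, by omega⟩, j), .inr ⟨rfl, Nat.odd_iff.2 hj, by
        simp only; omega⟩⟩
    rcases Nat.mod_two_eq_zero_or_one j.val with hj | hj
    · by_cases h : i.val + 1 < k
      · exact .inl (hout j hj h)
      · refine .inr ⟨.inr (by simp only; omega), ?_⟩
        rintro ⟨i', j'⟩ rfl hj'
        exact hin j' (by simp only at hj'; omega) (by omega)
    · by_cases h : 0 < i.val
      · exact .inl (hin j hj h)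
      · refine .inr ⟨.inl (by simp only; omega), ?_⟩
        rintro ⟨i', j'⟩ rfl hj'
        exact hout j' (by simp only at hj'; omega) (by omega)
  obtain ⟨u, rfl⟩ := Quot.exists_rep q
  rcases key u with ⟨v, hv⟩ | ⟨hu, hw⟩
  · exact ⟨u, v, hv, rfl⟩
  by_cases h : (u, u.succ) ∈ E
  · obtain ⟨v, hv⟩ := hw u.succ rfl (ZMod.val_add_one_mod_two u.2)
    exact ⟨u.succ, v, hv, (Quot.sound h).symm⟩
  · obtain ⟨w, hwu⟩ : ∃ w : GridVertex k, w.succ = u :=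
      ⟨(u.1, u.2 - 1), by simp [GridVertex.succ]⟩
    subst hwu
    have hwE : (w, w.succ) ∈ E := by
      by_contra h'
      exact h ((hE.alternate w hu).2 h')
    have h2 := ZMod.val_add_one_mod_two w.2
    obtain ⟨v, hv⟩ := hw w rfl (by simp only [GridVertex.succ]; omega)
    exact ⟨w, v, hv, Quot.sound hwE⟩

/-- The permutation that moves all vertices one step along the radial paths. -/
lemma exists_perm_radial [NeZero k] (hk : 2 ≤ k) :
    ∃ σ : Equiv.Perm (ContractedVertex E),
      (∀ q, q = σ q ∨ (contractArcs (cylindricalGrid k) E).Adj q (σ q)) ∧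
      ∀ u v : GridVertex k, RadialArc u v → σ (Quot.mk _ u) = Quot.mk _ v := by
  choose t h hth htq using hE.exists_radialArc hk
  have hinj : Function.Injective fun q => (Quot.mk _ (h q) : ContractedVertex E) := by
    intro q p hqp
    have hh : h q = h p := (hE.eq_or_of_mk_eq hqp).resolve_right fun hor =>
      hor.elim (hE.heads_not_mem (hth q) (hth p))
        (hE.heads_not_mem (hth p) (hth q))
    have htt : t q = t p := by
      have h1 := hth q
      have h2 := hth p
      rw [hh] at h1
      have hcol : (t q).2 = (t p).2 := by
        rcases h1 with h1 | h1 <;> rcases h2 with h2 | h2 <;> rw [← h1.1, ← h2.1]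
      refine Prod.ext (Fin.ext ?_) hcol
      simp only [RadialArc, hcol, Nat.even_iff, Nat.odd_iff] at h1 h2
      omega
    rw [← htq q, htt, htq]
  refine ⟨Equiv.ofBijective _ (Finite.injective_iff_bijective.1 hinj), fun q => ?_,
    fun u v huv => ?_⟩
  · have := valid_of_adj (E := E) (cylindricalGrid_adj.2 (.inr (hth q)))
    rwa [htq] at this
  · have htu : t (Quot.mk _ u) = u := hE.tail_eq_of_mk_eq (hth _) huv (htq _)
    have hv := hth (Quot.mk _ u)
    rw [htu] at hv
    have : h (Quot.mk _ u) = v := by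
      refine Prod.ext (Fin.ext ?_) ?_
      · simp only [RadialArc, Nat.even_iff, Nat.odd_iff] at hv huv
        omega
      · rcases hv with hv | hv <;> rcases huv with huv | huv <;> rw [hv.1, huv.1]
    rw [Equiv.ofBijective_apply, this]

lemma exists_perm_of_adj [NeZero k] (hk : 2 ≤ k) {q q' : ContractedVertex E}
    (h : (contractArcs (cylindricalGrid k) E).Adj q q') :
    ∃ σ : Equiv.Perm (ContractedVertex E),
      (∀ p, p = σ p ∨ (contractArcs (cylindricalGrid k) E).Adj p (σ p)) ∧ σ q = q' := by
  obtain ⟨hne, u, v, rfl, rfl, huv⟩ := h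
  rcases cylindricalGrid_adj.1 huv with rfl | huv
  · obtain ⟨σ, hσ, h, -⟩ := hE.exists_perm_rotate Set.univ
    exact ⟨σ, hσ, h u trivial fun hu => hne (Quot.sound hu)⟩
  · obtain ⟨σ, hσ, h⟩ := hE.exists_perm_radial hk
    exact ⟨σ, hσ, h u v huv⟩

end IsEndContraction

/-- Each cycle connects its vertices to column `0`, whose radial path meets all cycles. -/
lemma eqvGen_contractArcs_cylindricalGrid {k : ℕ} [NeZero k]
    (E : Set (GridVertex k × GridVertex k)) (q q' : ContractedVertex E) :
    Relation.EqvGen (contractArcs (cylindricalGrid k) E).Adj q q' := by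
  have hadj : ∀ {u v : GridVertex k}, (cylindricalGrid k).Adj u v →
      Relation.EqvGen (contractArcs (cylindricalGrid k) E).Adj (Quot.mk _ v) (Quot.mk _ u) := by
    intro u v h
    rcases IsEndContraction.valid_of_adj (E := E) h with h | h
    · rw [h]; exact .refl _
    · exact .symm _ _ (.rel _ _ h)
  have hbase : ∀ u : GridVertex k, Relation.EqvGen (contractArcs (cylindricalGrid k) E).Adj
      (Quot.mk _ u) (Quot.mk _ (0, 0)) := by
    rintro ⟨i, j⟩
    refine ZMod.induction_add_one (P := fun j => Relation.EqvGen
      (contractArcs (cylindricalGrid k) E).Adj (Quot.mk _ (i, j)) (Quot.mk _ (0, 0))) ?_ ?_ j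
    · obtain ⟨i, hi⟩ := i
      induction i with
      | zero => exact .refl _
      | succ i ih =>
        have h : (cylindricalGrid k).Adj (⟨i, by omega⟩, 0) (⟨i + 1, hi⟩, 0) :=
          cylindricalGrid_adj.2 (.inr (.inl ⟨rfl, by simp, rfl⟩))
        exact .trans _ _ _ (hadj h) (ih (by omega))
    · exact fun j ih => .trans _ _ _ (hadj (cylindricalGrid_adj.2 (.inl rfl))) ih
  obtain ⟨u, rfl⟩ := Quot.exists_rep q
  obtain ⟨v, rfl⟩ := Quot.exists_rep q'
  exact .trans _ _ _ (hbase u) (.symm _ _ (hbase v))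

/-! ### Cuts of the bipartite matching grid -/

/-- Here `x` and `y` record on which side the two ends of a matching edge lie. If nothing crosses
between the two rows, both are constant there. Crossing edges of `M` are found strictly between the
rows, hence off the end cycles, where no contraction can identify edges from different columns. -/
lemma exists_change_in_column {k : ℕ} {x y : GridVertex k → Prop} {i₁ i₂ : Fin k}
    (hlt : i₁ < i₂) (j : ZMod (2 * k)) (h₁ : x (i₁, j) ↔ y (i₁, j)) (h₂ : x (i₂, j) ↔ y (i₂, j))
    (hne : ¬ (x (i₁, j) ↔ x (i₂, j))) :
    (∃ u : GridVertex k, ¬ u.IsEnd ∧ u.2 = j ∧ ¬ (x u ↔ y u)) ∨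
      ∃ u v : GridVertex k, RadialArc u v ∧ u.2 = j ∧ ¬ (x u ↔ y v) := by
  by_contra! hcon
  obtain ⟨hM, hN⟩ := hcon
  have hxy : ∀ n (hn : n < k), i₁.val ≤ n → n ≤ i₂.val → (x (⟨n, hn⟩, j) ↔ y (⟨n, hn⟩, j)) := by
    intro n hn hn1 hn2
    rcases hn1.eq_or_lt with rfl | hn1
    · exact h₁
    rcases hn2.eq_or_lt with rfl | hn2
    · exact h₂
    refine hM (⟨n, hn⟩, j) ?_ rfl
    have := i₂.2
    simp only [IsEnd]
    omega
  have hind : ∀ n (hn : n < k), i₁.val ≤ n → n ≤ i₂.val → (x (i₁, j) ↔ x (⟨n, hn⟩, j)) := by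
    intro n hn hn1
    induction n, hn1 using Nat.le_induction with
    | base => exact fun _ => Iff.rfl
    | succ n hn1 ih =>
      intro hn2
      have hn' : n < k := by omega
      refine (ih hn' (by omega)).trans ?_
      have e1 := hxy n hn' hn1 (by omega)
      have e2 := hxy (n + 1) hn (by omega) hn2
      rcases Nat.even_or_odd j.val with hj | hj
      · exact (hN (⟨n, hn'⟩, j) (⟨n + 1, hn⟩, j) (.inl ⟨rfl, hj, rfl⟩) rfl).trans e2.symm
      · exact e1.trans (hN (⟨n + 1, hn⟩, j) (⟨n, hn'⟩, j) (.inr ⟨rfl, hj, rfl⟩) rfl).symm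
  exact hne (hind i₂.val i₂.2 hlt.le le_rfl)

section Cut

variable {k : ℕ} [NeZero k] {E : Set (GridVertex k × GridVertex k)} {V : Type*} [Finite V]
  {G : SimpleGraph V} {e : ContractedVertex E ⊕ ContractedVertex E ≃ V}

/-- If two concentric cycles lie on different sides of a cut, then all radial paths cross it. -/
lemma IsEndContraction.le_matchingPorosity_of_separated (hE : IsEndContraction E) (hk : 2 ≤ k)
    (hadj : ∀ q q', q = q' ∨ (contractArcs (cylindricalGrid k) E).Adj q q' →
      G.Adj (e (.inl q)) (e (.inr q'))) (X : Set V) {i₁ i₂ : Fin k} (hlt : i₁ < i₂)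
    (h₁ : ∀ j, e (.inl (Quot.mk _ (i₁, j))) ∈ X ↔ e (.inr (Quot.mk _ (i₁, j))) ∈ X)
    (h₂ : ∀ j, e (.inl (Quot.mk _ (i₂, j))) ∈ X ↔ e (.inr (Quot.mk _ (i₂, j))) ∈ X)
    (hne : ∀ j, ¬ (e (.inl (Quot.mk _ (i₁, j))) ∈ X ↔ e (.inl (Quot.mk _ (i₂, j))) ∈ X)) :
    k ≤ matchingPorosity G X := by
  classical
  let x : GridVertex k → Prop := fun u => e (.inl (Quot.mk _ u)) ∈ X
  let y : GridVertex k → Prop := fun u => e (.inr (Quot.mk _ u)) ∈ X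
  let P : ZMod (2 * k) → Prop := fun j => ∃ u : GridVertex k, ¬ u.IsEnd ∧ u.2 = j ∧ ¬ (x u ↔ y u)
  have hcol : ∀ j, P j ∨ ∃ u v : GridVertex k, RadialArc u v ∧ u.2 = j ∧ ¬ (x u ↔ y v) :=
    fun j => exists_change_in_column hlt j (h₁ j) (h₂ j) (hne j)
  -- Pigeonhole over the `2 * k` columns: either `P` or its negation holds for at least `k` of them.
  have hcard := Finset.card_filter_add_card_filter_not (s := Finset.univ) P
  rw [Finset.card_univ, ZMod.card] at hcard
  have hM : (Finset.univ.filter P).card ≤ matchingPorosity G X := by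
    have hP : ∀ j, ∃ u : GridVertex k, P j → ¬ u.IsEnd ∧ u.2 = j ∧ ¬ (x u ↔ y u) := fun j => by
      by_cases h : P j
      · exact h.imp fun u hu _ => hu
      · exact ⟨(i₁, j), fun h' => absurd h' h⟩
    choose u hu using hP
    refine card_le_matchingPorosity e G 1 (fun q => hadj q q (.inl rfl)) X _
      (fun j => Quot.mk _ (u j)) ?_ ?_
    · intro j hj j' hj' h
      have hj := hu j (Finset.mem_filter.1 hj).2
      have hj' := hu j' (Finset.mem_filter.1 hj').2
      have : u j = u j' := (hE.eq_or_of_mk_eq h).resolve_right fun hor =>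
        hor.elim (fun h => hj.1 (hE.isEnd h)) fun h => hj'.1 (hE.isEnd h)
      rw [← hj.2.1, this, hj'.2.1]
    · exact fun j hj => (hu j (Finset.mem_filter.1 hj).2).2.2
  have hN : (Finset.univ.filter (¬ P ·)).card ≤ matchingPorosity G X := by
    obtain ⟨σ, hσ, hσr⟩ := hE.exists_perm_radial hk
    have hP : ∀ j, ∃ u v : GridVertex k, ¬ P j → RadialArc u v ∧ u.2 = j ∧ ¬ (x u ↔ y v) :=
      fun j => by
        by_cases h : P j
        · exact ⟨(i₁, j), (i₁, j), fun h' => absurd h h'⟩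
        · obtain ⟨u, v, huv⟩ := (hcol j).resolve_left h
          exact ⟨u, v, fun _ => huv⟩
    choose u v huv using hP
    refine card_le_matchingPorosity e G σ (fun q => hadj q _ (hσ q)) X _
      (fun j => Quot.mk _ (u j)) ?_ ?_
    · intro j hj j' hj' h
      have hj := huv j (Finset.mem_filter.1 hj).2
      have hj' := huv j' (Finset.mem_filter.1 hj').2
      rw [← hj.2.1, hE.tail_eq_of_mk_eq hj.1 hj'.1 h, hj'.2.1]
    · intro j hj
      have hj := huv j (Finset.mem_filter.1 hj).2
      rw [hσr _ _ hj.1]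
      exact hj.2.2
  omega

open Classical in
/-- The number of concentric cycles that meet both sides of a cut is at most its porosity. -/
lemma IsEndContraction.card_le_matchingPorosity_of_crossing (hE : IsEndContraction E)
    (hadj : ∀ q q', q = q' ∨ (contractArcs (cylindricalGrid k) E).Adj q q' →
      G.Adj (e (.inl q)) (e (.inr q'))) (X : Set V) (s : Finset (Fin k))
    (hs : ∀ i ∈ s, ∃ j, ¬ (e (.inl (Quot.mk _ (i, j))) ∈ X ↔ e (.inr (Quot.mk _ (i, j))) ∈ X) ∨
      ¬ (e (.inl (Quot.mk _ (i, j))) ∈ X ↔ e (.inr (Quot.mk _ (i, j + 1))) ∈ X)) :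
    s.card ≤ matchingPorosity G X := by
  let P : Fin k → Prop := fun i =>
    ∃ j, ¬ (e (.inl (Quot.mk _ (i, j))) ∈ X ↔ e (.inr (Quot.mk _ (i, j))) ∈ X)
  -- Cycles with a crossing edge of `M` keep `M`; the others are rotated.
  obtain ⟨σ, hσ, hσ1, hσ2⟩ := hE.exists_perm_rotate {i | ¬ P i}
  have hj : ∀ i, ∃ j, i ∈ s → ¬ (e (.inl (Quot.mk _ (i, j))) ∈ X ↔
      e (.inr (σ (Quot.mk _ (i, j)))) ∈ X) := by
    intro i
    by_cases hi : i ∈ s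
    · by_cases hP : P i
      · obtain ⟨j, hj⟩ := id hP
        refine ⟨j, fun _ => ?_⟩
        rwa [hσ2 (i, j) (by simpa using hP)]
      · obtain ⟨j, hj⟩ := hs i hi
        have hno : e (.inl (Quot.mk _ (i, j))) ∈ X ↔ e (.inr (Quot.mk _ (i, j))) ∈ X := by
          by_contra h
          exact hP ⟨j, h⟩
        have hj := hj.resolve_left (not_not.2 hno)
        refine ⟨j, fun _ => ?_⟩
        rw [hσ1 (i, j) hP fun hmem => ?_]
        · exact hj
        -- A contracted arc cannot cross, since its ends are the same class and `M` does not cross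
        -- there.
        · rw [hno, show (Quot.mk _ (i, j) : ContractedVertex E) = Quot.mk _ (i, j + 1) from
            Quot.sound hmem] at hj
          exact hj Iff.rfl
    · exact ⟨0, fun h => absurd h hi⟩
  choose j hj using hj
  refine card_le_matchingPorosity e G σ (fun q => hadj q _ (hσ q)) X s
    (fun i => Quot.mk _ (i, j i)) ?_ hj
  exact fun i _ i' _ h => hE.fst_eq_of_mk_eq h

lemma IsEndContraction.le_three_mul_perfectMatchingWidth (hE : IsEndContraction E) (hk : 2 ≤ k)
    (hadj : ∀ q q', q = q' ∨ (contractArcs (cylindricalGrid k) E).Adj q q' →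
      G.Adj (e (.inl q)) (e (.inr q'))) : k ≤ 3 * perfectMatchingWidth G := by
  classical
  let a : Fin k ↪ V := ⟨fun i => e (.inl (Quot.mk _ (i, 0))), fun i i' h =>
    hE.fst_eq_of_mk_eq (Sum.inl.inj (e.injective h))⟩
  have hcard : (Finset.univ.map a).card = k := by simp
  obtain ⟨X, h1, h2, hX⟩ :=
    exists_balanced_matchingPorosity_le G (Finset.univ.map a) (by rwa [hcard])
  refine le_trans ?_ (Nat.mul_le_mul_left 3 hX)
  rw [hcard, Finset.filter_map, Finset.card_map] at h1 h2
  let s : Finset (Fin k) := Finset.univ.filter fun i =>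
    ∃ j, ¬ (e (.inl (Quot.mk _ (i, j))) ∈ X ↔ e (.inr (Quot.mk _ (i, j))) ∈ X) ∨
      ¬ (e (.inl (Quot.mk _ (i, j))) ∈ X ↔ e (.inr (Quot.mk _ (i, j + 1))) ∈ X)
  have hs := hE.card_le_matchingPorosity_of_crossing hadj X s fun i hi => (Finset.mem_filter.1 hi).2
  by_contra! hlt
  -- Each side has at least `k / 3` marked vertices, more than there are crossing cycles, so each
  -- side contains an uncrossed cycle.
  obtain ⟨i₁, hi₁, hs₁⟩ := Finset.exists_mem_notMem_of_card_lt_card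
    (show s.card < (Finset.univ.filter ((· ∈ X) ∘ a)).card by omega)
  obtain ⟨i₂, hi₂, hs₂⟩ := Finset.exists_mem_notMem_of_card_lt_card
    (show s.card < (Finset.univ.filter ((· ∉ X) ∘ a)).card by omega)
  have hconst : ∀ i, i ∉ s →
      (∀ j, e (.inl (Quot.mk _ (i, j))) ∈ X ↔ e (.inr (Quot.mk _ (i, j))) ∈ X) ∧
      ∀ j, e (.inl (Quot.mk _ (i, j))) ∈ X ↔ e (.inl (Quot.mk _ (i, 0))) ∈ X := by
    intro i hi
    simp only [s, Finset.mem_filter, Finset.mem_univ, true_and] at hi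
    push Not at hi
    refine ⟨fun j => (hi j).1, ZMod.induction_add_one Iff.rfl fun j ih => ?_⟩
    rw [(hi (j + 1)).1, ← (hi j).2, ih]
  have hx₁ : e (.inl (Quot.mk _ (i₁, 0))) ∈ X := (Finset.mem_filter.1 hi₁).2
  have hx₂ : e (.inl (Quot.mk _ (i₂, 0))) ∉ X := (Finset.mem_filter.1 hi₂).2
  have hne : ∀ j, ¬ (e (.inl (Quot.mk _ (i₁, j))) ∈ X ↔ e (.inl (Quot.mk _ (i₂, j))) ∈ X) :=
    fun j => by
      rw [(hconst i₁ hs₁).2 j, (hconst i₂ hs₂).2 j]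
      tauto
  have : k ≤ matchingPorosity G X := by
    rcases lt_trichotomy i₁ i₂ with h | rfl | h
    · exact hE.le_matchingPorosity_of_separated hk hadj X h (hconst i₁ hs₁).1 (hconst i₂ hs₂).1 hne
    · exact absurd hx₁ hx₂
    · exact hE.le_matchingPorosity_of_separated hk hadj X h (hconst i₂ hs₂).1 (hconst i₁ hs₁).1
        fun j h' => hne j h'.symm
  omega

end Cut

/-! ### Order one and the conclusion -/

lemma IsMatchingCovered.perfectMatchingWidth_pos {V : Type*} [Finite V] {G : SimpleGraph V}
    (hG : IsMatchingCovered G) {v w : V} (hvw : v ≠ w) : 0 < perfectMatchingWidth G := by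
  classical
  have hcard := Finset.card_pair hvw
  obtain ⟨X, h1, h2, hX⟩ := exists_balanced_matchingPorosity_le G {v, w} hcard.ge
  obtain ⟨x, hx⟩ := Finset.card_pos.1 (show 0 < (Finset.filter (· ∈ X) {v, w}).card by omega)
  obtain ⟨y, hy⟩ := Finset.card_pos.1 (show 0 < (Finset.filter (· ∉ X) {v, w}).card by omega)
  exact (hG.matchingPorosity_pos (Finset.mem_filter.1 hx).2 (Finset.mem_filter.1 hy).2).trans_le hX

lemma IsEverySecondArc.subsingleton_contractedVertex
    {Eo Ei : Set (GridVertex 1 × GridVertex 1)} {i : Fin 1} (hEo : IsEverySecondArc i Eo) :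
    Subsingleton (ContractedVertex (Eo ∪ Ei)) := by
  obtain ⟨j, hj⟩ : ∃ j, cycleArc i j ∈ Eo := by
    by_contra! h
    exact h _ ((hEo.2 0).2 (h 0))
  have hall : ∀ u : GridVertex 1, (Quot.mk _ u : ContractedVertex (Eo ∪ Ei)) =
      Quot.mk _ (i, j) := by
    rintro ⟨i', j'⟩
    obtain rfl : i' = i := Subsingleton.elim _ _
    have h2 : ∀ j j' : ZMod (2 * 1), j' = j ∨ j' = j + 1 := by decide
    have := h2 j j'
    rcases this with rfl | rfl
    · rfl
    · exact (Quot.sound (.inl hj)).symm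
  refine ⟨fun p q => ?_⟩
  obtain ⟨u, rfl⟩ := Quot.exists_rep p
  obtain ⟨v, rfl⟩ := Quot.exists_rep q
  rw [hall u, hall v]

theorem mainTheorem9 (k : ℕ) (hk : 0 < k)
    (Eo Ei : Set ((Fin k × ZMod (2 * k)) × (Fin k × ZMod (2 * k))))
    (hEo : IsEverySecondArc (⟨k - 1, Nat.sub_lt hk Nat.one_pos⟩ : Fin k) Eo)
    (hEi : IsEverySecondArc (⟨0, hk⟩ : Fin k) Ei) :
    (∃ (n : ℕ) (G : SimpleGraph (Fin n)), IsBipartiteMatchingGrid k Eo Ei G) ∧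
    ∀ (V : Type*) [Finite V] (G : SimpleGraph V), IsBipartiteMatchingGrid k Eo Ei G →
      (k : ℝ) / 3 ≤ (perfectMatchingWidth G : ℝ) := by
  have : NeZero k := ⟨hk.ne'⟩
  have hE : 2 ≤ k → IsEndContraction (Eo ∪ Ei) := fun h =>
    isEndContraction_union h (Nat.sub_add_cancel hk) rfl hEo hEi
  constructor
  · obtain ⟨n, ⟨e⟩⟩ :=
      Finite.exists_equiv_fin (ContractedVertex (Eo ∪ Ei) ⊕ ContractedVertex (Eo ∪ Ei))
    have : Nonempty (ContractedVertex (Eo ∪ Ei)) := ⟨Quot.mk _ (0, 0)⟩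
    refine ⟨n, splitGraph e (contractArcs (cylindricalGrid k) (Eo ∪ Ei)),
      splitGraph_isMatchingCovered _ (fun q q' h => ?_) (eqvGen_contractArcs_cylindricalGrid _),
      _, splitGraph_isBipartiteWith _, exists_matchingDirection_splitGraph _ fun q h => h.1 rfl⟩
    -- For `k = 1` both sets live on the same cycle and their union need not alternate, but the
    -- quotient is a single vertex and has no arcs.
    rcases (show 1 ≤ k from hk).eq_or_lt with rfl | h2
    · have := hEo.subsingleton_contractedVertex (Ei := Ei)
      exact absurd (Subsingleton.elim q q') h.1
    · exact (hE h2).exists_perm_of_adj h2 h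
  · rintro V _ G ⟨hG, A, hA, M, hM, ⟨φ⟩⟩
    obtain ⟨e, he⟩ := exists_equiv_of_matchingDirection hA hM φ
    have key : k ≤ 3 * perfectMatchingWidth G := by
      rcases (show 1 ≤ k from hk).eq_or_lt with rfl | h2
      · have := hG.perfectMatchingWidth_pos (v := e (.inl (Quot.mk _ (0, 0))))
          (w := e (.inr (Quot.mk _ (0, 0)))) fun h => Sum.inl_ne_inr (e.injective h)
        omega
      · exact (hE h2).le_three_mul_perfectMatchingWidth h2 he
    have : (k : ℝ) ≤ 3 * perfectMatchingWidth G := by exact_mod_cast key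
    linarith
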